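/- Consider the $\mathsf{CONGEST}$ model: the input is a connected graph $G$ with vertex set $\{0,\dots,n-1\}$, whose vertices are the computing nodes and whose names are their unique identifiers. All vertices know $n$, and every vertex initially knows its own identifier and those of its neighbours; all vertices run the same algorithm, with unrestricted local computation, in synchronous rounds; in each round every vertex may send to each of its neighbours a message of at most $b$ bits, possibly different for different neighbours. An algorithm solves induced $m$-cycle detection in $T$ rounds on $n$-vertex networks if, for every connected $G$ on $\{0,\dots,n-1\}$, after $T$ rounds at least one vertex reports "yes" if $G$ contains an induced cycle of length $m$, and no vertex does so otherwise. A randomized algorithm (whose vertices may use a common random seed; private coins are a special case) solves the problem if for every such $G$ this holds with probability at least $2/3$. **Theorem.** Let $k \ge 3$ and $\beta \in \mathbb{R}$. There are a constant $c > 0$ and an $n_0$, depending only on $k$ and $\beta$, such that for all $n \ge n_0$, every deterministic algorithm and every randomized algorithm that uses messages of at most $b \le \beta \log n$ bits and solves induced $2k$-cycle detection in $T$ rounds on $n$-vertex networks satisfies $T \ge c\, n/\log n$. That is, induced $2k$-cycle detection needs $\Omega(n/\log n)$ rounds in $\mathsf{CONGEST}$, both deterministically and with randomization. -/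

import Mathlib

namespace Congest

/-- A message of a `CONGEST` network of bandwidth `b`: a string of at most `b` bits.
The empty string also plays the role of sending nothing. -/
def Message (b : ℕ) : Type := {l : List Bool // l.length ≤ b}

/-- The empty message. -/
def Message.silent (b : ℕ) : Message b := ⟨[], Nat.zero_le b⟩

/-- A deterministic distributed algorithm for `n`-vertex networks with bandwidth `b`.

The vertices of the network are `Fin n`, and the name of a vertex is its unique identifier.
All vertices run the same algorithm and know `n`; initially a vertex knows its own identifier
and the identifiers of its neighbours.  Local computation is unrestricted. -/
structure Algorithm (n b : ℕ) where
  /-- the local states of a vertex -/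
  State : Type
  /-- the initial state, from the own identifier and the set of identifiers of the neighbours -/
  init : Fin n → Set (Fin n) → State
  /-- `send s w` is the message that a vertex in state `s` sends to its neighbour `w` -/
  send : State → Fin n → Message b
  /-- the state after a round, from the state before it and the messages received in it,
  indexed by their senders -/
  receive : State → (Fin n → Message b) → State
  /-- whether a vertex that stops in this state reports that the input is a yes-instance -/
  output : State → Bool

namespace Algorithm

variable {n b : ℕ}

open Classical in
/-- The state of each vertex after `t` synchronous rounds on the network `G`: in a round every
vertex sends one message, which may differ from edge to edge, along each incident edge.
Nothing is received from vertices that are not neighbours. -/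
noncomputable def run (A : Algorithm n b) (G : SimpleGraph (Fin n)) : ℕ → Fin n → A.State
  | 0, v => A.init v (G.neighborSet v)
  | t + 1, v =>
      A.receive (A.run G t v) fun w =>
        if G.Adj w v then A.send (A.run G t w) v else Message.silent b

/-- On the network `G`, some vertex reports a yes-instance after `T` rounds. -/
def Accepts (A : Algorithm n b) (T : ℕ) (G : SimpleGraph (Fin n)) : Prop :=
  ∃ v : Fin n, A.output (A.run G T v) = true

/-- After `T` rounds the algorithm answers correctly on `G` whether `G` contains an induced cycle
of length `m`: if it does, at least one vertex reports a yes-instance, and otherwise no vertex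
does.  In particular this holds when all vertices of induced `m`-cycles report a yes-instance
and no vertex does so if there is no such cycle. -/
def CorrectOn (A : Algorithm n b) (m T : ℕ) (G : SimpleGraph (Fin n)) : Prop :=
  A.Accepts T G ↔ (SimpleGraph.cycleGraph m).IsIndContained G

/-- The deterministic algorithm `A` solves induced `m`-cycle detection in `T` rounds on all
connected networks with `n` vertices. -/
def SolvesInducedCycle (A : Algorithm n b) (m T : ℕ) : Prop :=
  ∀ G : SimpleGraph (Fin n), G.Connected → A.CorrectOn m T G

end Algorithm

open MeasureTheory in
/-- A randomized algorithm is a deterministic algorithm `A ω` that depends on a random seed `ω`,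
drawn from a probability space `(Ω, μ)` and known to all vertices.  (Independent private coins are
the case in which `ω` is a family of independent seeds, one for each identifier, and a vertex uses
only its own.)  It solves induced `m`-cycle detection in `T` rounds if on each connected network
with `n` vertices it is correct with probability at least `2/3`. -/
def RandomizedSolvesInducedCycle {n b : ℕ} {Ω : Type*} [MeasurableSpace Ω] (μ : Measure Ω)
    (A : Ω → Algorithm n b) (m T : ℕ) : Prop :=
  ∀ G : SimpleGraph (Fin n), G.Connected →
    MeasurableSet {ω | (A ω).CorrectOn m T G} ∧
      (2 / 3 : ℝ) ≤ μ.real {ω | (A ω).CorrectOn m T G}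

end Congest

/-!
Two players who hold `x, y ∈ {0, 1} ^ (p * p)` and hence, respectively, the edges on two sides of a
graph can simulate an algorithm on this graph by exchanging the messages that cross between the two
sides. The levels of the graph are `m` cliques of about `n / m = p + 1` vertices, arranged
cyclically. Since two vertices on one level are adjacent, an induced `m`-cycle has to go around and
to visit each level exactly once. If `x` prescribes the edges between two consecutive levels, `y`
those between two other ones, and the remaining levels are matched, then such a cycle is a common
element of `x` and `y`. Only `O(p)` edges cross between the sides, so `T` rounds transmit
`O(p * b * T)` bits, whereas it takes `Ω(p ^ 2)` bits to decide whether `x` and `y` are disjoint.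
Hence `b * T = Ω(p) = Ω(n)`.

The communication bound only uses pairs with at most one common element. The pairs with a given
transcript form a rectangle. In a rectangle that is not exponentially small, a disjoint pair has
almost maximal entropy, so by the chain rule a typical coordinate of `x`, and one of `y`, is almost
uniform given the others. One common element can then be inserted at a constant proportion of the
coordinates without leaving the rectangle. A protocol that declares most disjoint pairs to be
disjoint is therefore wrong for a large part of the pairs with one common element.
-/

namespace UniqueDisjointness

open Finset Real

variable {n : ℕ}

/-- Relative entropy, with respect to the uniform measure, of the measure on two points with
weights `a` and `b`, which need not be normalized. -/
noncomputable def twoPointKL (a b : ℝ) : ℝ :=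
  negMulLog (a + b) - negMulLog a - negMulLog b + (a + b) * log 2

theorem twoPointKL_comm (a b : ℝ) : twoPointKL a b = twoPointKL b a := by
  simp only [twoPointKL, add_comm b a]
  ring

theorem sub_le_mul_log_sub_log {a m : ℝ} (ha : 0 ≤ a) (hm : 0 < m) :
    a - m ≤ a * (log a - log m) := by
  rcases ha.eq_or_lt with rfl | ha
  · simp [hm.le]
  · have h := one_sub_inv_le_log_of_pos (div_pos ha hm)
    rw [log_div ha.ne' hm.ne'] at h
    calc a - m = a * (1 - (a / m)⁻¹) := by field_simp
      _ ≤ _ := mul_le_mul_of_nonneg_left h ha.le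

-- The variational formula for relative entropy, tested against the density `(s, t)`.
theorem mul_log_add_mul_log_le_twoPointKL {a b s t : ℝ} (ha : 0 ≤ a) (hb : 0 ≤ b) (hs : 0 < s)
    (ht : 0 < t) (hst : s + t = 2) : a * log s + b * log t ≤ twoPointKL a b := by
  rcases (add_nonneg ha hb).eq_or_lt with h | h
  · obtain rfl : a = 0 := by linarith
    obtain rfl : b = 0 := by linarith
    simp [twoPointKL]
  · have hmid := half_pos h
    have h1 := sub_le_mul_log_sub_log ha (mul_pos hs hmid)
    have h2 := sub_le_mul_log_sub_log hb (mul_pos ht hmid)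
    rw [log_mul hs.ne' hmid.ne', log_div h.ne' two_ne_zero] at h1
    rw [log_mul ht.ne' hmid.ne', log_div h.ne' two_ne_zero] at h2
    have h3 : a - s * ((a + b) / 2) + (b - t * ((a + b) / 2)) = 0 := by
      linear_combination -(a + b) / 2 * hst
    unfold twoPointKL negMulLog
    linarith

theorem twoPointKL_nonneg {a b : ℝ} (ha : 0 ≤ a) (hb : 0 ≤ b) : 0 ≤ twoPointKL a b := by
  simpa using mul_log_add_mul_log_le_twoPointKL ha hb one_pos one_pos (by norm_num)

theorem div_le_twoPointKL {a b : ℝ} (hb : 0 ≤ b) (hab : b ≤ 7 / 8 * a) :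
    a / 300 ≤ twoPointKL a b := by
  have ha : 0 ≤ a := by linarith
  have hlog : 8 / 300 ≤ 8 * log (16 / 15) + 7 * log (14 / 15) := by
    calc (8 / 300 : ℝ) ≤ 1 - ((16 / 15 : ℝ) ^ 8 * (14 / 15) ^ 7)⁻¹ := by norm_num
      _ ≤ log ((16 / 15) ^ 8 * (14 / 15) ^ 7) := one_sub_inv_le_log_of_pos (by norm_num)
      _ = 8 * log (16 / 15) + 7 * log (14 / 15) := by
        rw [log_mul (by norm_num) (by norm_num), log_pow, log_pow]
        norm_num
  have hneg : log (14 / 15 : ℝ) ≤ 0 := log_nonpos (by norm_num) (by norm_num)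
  -- `(16 / 15, 14 / 15)` is the normalization of the extreme case `(1, 7 / 8)`.
  calc a / 300 ≤ a * log (16 / 15) + 7 / 8 * a * log (14 / 15) := by
        linarith [mul_le_mul_of_nonneg_left hlog ha]
    _ ≤ a * log (16 / 15) + b * log (14 / 15) := by
        linarith [mul_le_mul_of_nonpos_right hab hneg]
    _ ≤ twoPointKL a b := mul_log_add_mul_log_le_twoPointKL ha hb (by norm_num) (by norm_num)
        (by norm_num)

-- Either `b` and `d` are comparable to `a` and `c`, and then `b * d` pays for the left-hand side,
-- or one of the two pairs is unbalanced, and then its entropy does.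
theorem two_point_inequality {a b c d : ℝ} (ha : 0 ≤ a) (hb : 0 ≤ b) (hc : 0 ≤ c) (hd : 0 ≤ d) :
    1 / 4 * (a * c + b * c + a * d) ≤
      b * d + 300 * (c * twoPointKL a b + a * twoPointKL c d) := by
  have hKL_ab := mul_nonneg hc (twoPointKL_nonneg ha hb)
  have hKL_cd := mul_nonneg ha (twoPointKL_nonneg hc hd)
  have hbd := mul_nonneg hb hd
  rcases le_or_gt b (7 / 8 * a) with hba | hab
  · have hKL := mul_le_mul_of_nonneg_left (div_le_twoPointKL hb hba) hc
    have hbc := mul_le_mul_of_nonneg_right hba hc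
    rcases le_or_gt c (7 / 8 * d) with hcd | hdc
    · have hKL' := mul_le_mul_of_nonneg_left (div_le_twoPointKL hc hcd) ha
      rw [twoPointKL_comm] at hKL'
      linarith
    · linarith [mul_le_mul_of_nonneg_left hdc.le ha]
  · rcases le_or_gt d (7 / 8 * c) with hdc | hcd
    · have hKL := mul_le_mul_of_nonneg_left (div_le_twoPointKL hd hdc) ha
      have had := mul_le_mul_of_nonneg_left hdc ha
      rcases le_or_gt a (7 / 8 * b) with hab' | hba
      · have hKL' := mul_le_mul_of_nonneg_left (div_le_twoPointKL ha hab') hc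
        rw [twoPointKL_comm] at hKL'
        linarith
      · linarith [mul_le_mul_of_nonneg_right hba.le hc]
    · linarith [mul_le_mul_of_nonneg_left hcd.le hb, mul_le_mul_of_nonneg_right hab.le hd,
        mul_le_mul_of_nonneg_right hab.le hc]

/-- The subsets of `Fin n`, encoded by their indicator functions so that `Fin.cons` adds a
coordinate. -/
abbrev Cube (n : ℕ) : Type := Fin n → Bool

/-- The size of the intersection of two subsets of `Fin n`. -/
def interCard (x y : Cube n) : ℕ := #{i | x i ∧ y i}

theorem interCard_comm (x y : Cube n) : interCard x y = interCard y x := by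
  simp only [interCard, and_comm]

theorem interCard_cons (a b : Bool) (x y : Cube n) :
    interCard (Fin.cons a x : Cube (n + 1)) (Fin.cons b y) = (a && b).toNat + interCard x y := by
  simp only [interCard, Fin.card_filter_univ_succ, Fin.cons_zero, Fin.cons_succ]
  cases a <;> cases b <;> simp [add_comm]

theorem interCard_ne_zero {x y : Cube n} : interCard x y ≠ 0 ↔ ∃ i, x i ∧ y i := by
  simp [interCard]

/-- The pairs of subsets of `Fin n` with exactly `j` common elements. -/
def pairs (n j : ℕ) : Finset (Cube n × Cube n) := {p | interCard p.1 p.2 = j}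

theorem mem_pairs {j : ℕ} {p : Cube n × Cube n} : p ∈ pairs n j ↔ interCard p.1 p.2 = j := by
  simp [pairs]

theorem sum_cube_succ {M : Type*} [AddCommMonoid M] (f : Cube (n + 1) → M) :
    ∑ x, f x = ∑ x : Cube n, (f (Fin.cons false x) + f (Fin.cons true x)) := by
  rw [← (Fin.consEquiv fun _ => Bool).sum_comp, Fintype.sum_prod_type, Fintype.sum_bool, add_comm,
    ← sum_add_distrib]
  rfl

/-- The restriction of `u` to the face of the cube on which the first coordinate is `a`. -/
def face (a : Bool) (u : Cube (n + 1) → ℝ) : Cube n → ℝ := fun x => u (Fin.cons a x)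

/-- The sum of `u` over all sets that have exactly `j` elements in common with `y`. -/
def slice (j : ℕ) (u : Cube n → ℝ) (y : Cube n) : ℝ :=
  ∑ x, if interCard x y = j then u x else 0

theorem slice_add (j : ℕ) (u w : Cube n → ℝ) (y : Cube n) :
    slice j (u + w) y = slice j u y + slice j w y := by
  simp only [slice, ← sum_add_distrib]
  refine sum_congr rfl fun x _ => ?_
  split_ifs <;> simp

theorem slice_nonneg {j : ℕ} {u : Cube n → ℝ} (hu : ∀ x, 0 ≤ u x) (y : Cube n) :
    0 ≤ slice j u y :=
  sum_nonneg fun x _ => by split_ifs <;> simp [hu x]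

theorem slice_cons_false (j : ℕ) (u : Cube (n + 1) → ℝ) (y : Cube n) :
    slice j u (Fin.cons false y) = slice j (face false u) y + slice j (face true u) y := by
  simp [slice, sum_cube_succ, interCard_cons, face, sum_add_distrib]

theorem slice_zero_cons_true (u : Cube (n + 1) → ℝ) (y : Cube n) :
    slice 0 u (Fin.cons true y) = slice 0 (face false u) y := by
  simp [slice, sum_cube_succ, interCard_cons, face]

theorem slice_one_cons_true (u : Cube (n + 1) → ℝ) (y : Cube n) :
    slice 1 u (Fin.cons true y) = slice 1 (face false u) y + slice 0 (face true u) y := by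
  simp [slice, sum_cube_succ, interCard_cons, face, sum_add_distrib]

theorem slice_zero_one_pos (y : Cube n) : 0 < slice 0 (1 : Cube n → ℝ) y :=
  sum_pos' (fun x _ => by split_ifs <;> simp) ⟨fun _ => false, mem_univ _, by simp [interCard]⟩

theorem face_one (a : Bool) : face a (1 : Cube (n + 1) → ℝ) = 1 := rfl

theorem face_comp (f : ℝ → ℝ) (a : Bool) (u : Cube (n + 1) → ℝ) :
    face a (f ∘ u) = f ∘ face a u := rfl

theorem log_slice_one_cons_false (y : Cube n) :
    log (slice 0 1 (Fin.cons false y : Cube (n + 1))) = log (slice 0 1 y) + log 2 := by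
  rw [slice_cons_false, face_one, face_one, ← two_mul,
    log_mul two_ne_zero (slice_zero_one_pos y).ne', add_comm]

theorem log_slice_one_cons_true (y : Cube n) :
    log (slice 0 1 (Fin.cons true y : Cube (n + 1))) = log (slice 0 1 y) := by
  rw [slice_zero_cons_true, face_one]

/-- The total weight `u x * v y` of the pairs `(x, y)` with exactly `j` common elements. -/
def pairing (j : ℕ) (u v : Cube n → ℝ) : ℝ := ∑ y, v y * slice j u y

theorem pairing_comm (j : ℕ) (u v : Cube n → ℝ) : pairing j u v = pairing j v u := by
  simp only [pairing, slice, mul_sum]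
  rw [sum_comm]
  refine sum_congr rfl fun x _ => sum_congr rfl fun y _ => ?_
  rw [interCard_comm]
  split_ifs <;> ring

theorem pairing_add_left (j : ℕ) (u w v : Cube n → ℝ) :
    pairing j (u + w) v = pairing j u v + pairing j w v := by
  simp only [pairing, slice_add, mul_add, sum_add_distrib]

theorem pairing_zero_succ (u v : Cube (n + 1) → ℝ) :
    pairing 0 u v =
      pairing 0 (face false u + face true u) (face false v) +
        pairing 0 (face false u) (face true v) := by
  simp only [pairing, sum_cube_succ, slice_cons_false, slice_zero_cons_true, slice_add, face,
    sum_add_distrib]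

theorem pairing_one_succ (u v : Cube (n + 1) → ℝ) :
    pairing 1 u v =
      pairing 1 (face false u + face true u) (face false v) +
        pairing 1 (face false u) (face true v) + pairing 0 (face true u) (face true v) := by
  simp only [pairing, sum_cube_succ, slice_cons_false, slice_one_cons_true, slice_add, face,
    sum_add_distrib, mul_add, add_assoc]

theorem pairing_zero_one_one (n : ℕ) : pairing 0 (1 : Cube n → ℝ) 1 = 3 ^ n := by
  induction n with
  | zero => simp [pairing, slice, interCard]
  | succ n ih =>
    rw [pairing_zero_succ, face_one, face_one, pairing_add_left, ih]
    ring

theorem pairing_one_one_one (n : ℕ) : pairing 1 (1 : Cube n → ℝ) 1 = n * 3 ^ n / 3 := by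
  induction n with
  | zero => simp [pairing, slice, interCard]
  | succ n ih =>
    rw [pairing_one_succ, face_one, face_one, pairing_add_left, ih, pairing_zero_one_one]
    push_cast
    ring

theorem pairing_indicator (j : ℕ) (A B : Set (Cube n)) [DecidablePred (· ∈ A)]
    [DecidablePred (· ∈ B)] :
    pairing j (A.indicator 1) (B.indicator 1) =
      #{p ∈ pairs n j | p.1 ∈ A ∧ p.2 ∈ B} := by
  simp only [pairing, slice, mul_sum, pairs, filter_filter, natCast_card_filter,
    Fintype.sum_prod_type]
  rw [sum_comm]
  refine sum_congr rfl fun x _ => sum_congr rfl fun y _ => ?_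
  simp only [Set.indicator_apply, Pi.one_apply]
  split_ifs <;> simp_all

theorem card_pairs (n j : ℕ) : (#(pairs n j) : ℝ) = pairing j (1 : Cube n → ℝ) 1 := by
  simpa using (pairing_indicator (n := n) j Set.univ Set.univ).symm

/-- The relative entropy, with respect to the uniform measure on the sets disjoint from `y`, of a
random set `x` given `y`, where a disjoint pair `(x, y)` has weight `u x * v y`. -/
noncomputable def condKL (u v : Cube n → ℝ) : ℝ :=
  ∑ y, v y * (negMulLog (slice 0 u y) - slice 0 (negMulLog ∘ u) y
    + slice 0 u y * log (slice 0 1 y))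

theorem slice_zero_twoPointKL (u w : Cube n → ℝ) (y : Cube n) :
    slice 0 (fun x => twoPointKL (u x) (w x)) y =
      slice 0 (negMulLog ∘ (u + w)) y - slice 0 (negMulLog ∘ u) y - slice 0 (negMulLog ∘ w) y
        + slice 0 (u + w) y * log 2 := by
  simp only [slice, sum_mul, ← sum_add_distrib, ← sum_sub_distrib]
  refine sum_congr rfl fun x _ => ?_
  split_ifs <;> simp [twoPointKL]

-- The chain rule, with the first coordinate of `x` revealed after the others.
theorem condKL_succ_last (u v : Cube (n + 1) → ℝ) :
    condKL u v = condKL (face false u + face true u) (face false v) +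
      condKL (face false u) (face true v) +
      ∑ x, slice 0 (face false v) x * twoPointKL (face false u x) (face true u x) := by
  have hswap : ∑ x, slice 0 (face false v) x * twoPointKL (face false u x) (face true u x) =
      pairing 0 (fun x => twoPointKL (face false u x) (face true u x)) (face false v) := by
    rw [pairing_comm]
    simp only [pairing, mul_comm]
  rw [hswap]
  simp only [condKL, pairing, sum_cube_succ, ← sum_add_distrib]
  refine sum_congr rfl fun y _ => ?_
  rw [slice_zero_twoPointKL, log_slice_one_cons_false, log_slice_one_cons_true]
  simp only [slice_cons_false, slice_zero_cons_true, slice_add, face_comp]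
  simp only [face]
  ring

-- The chain rule, with the first coordinate of `x` revealed before the others.
theorem condKL_succ_first (u v : Cube (n + 1) → ℝ) :
    condKL u v = condKL (face false u) (face false v + face true v) +
      condKL (face true u) (face false v) +
      ∑ y, face false v y * twoPointKL (slice 0 (face false u) y) (slice 0 (face true u) y) := by
  simp only [condKL, sum_cube_succ, ← sum_add_distrib]
  refine sum_congr rfl fun y _ => ?_
  rw [log_slice_one_cons_false, log_slice_one_cons_true]
  simp only [slice_cons_false, slice_zero_cons_true, twoPointKL, Pi.add_apply, face_comp]
  simp only [face]
  ring

theorem pairing_zero_le_succ {u v : Cube (n + 1) → ℝ} (hu : ∀ x, 0 ≤ u x) (hv : ∀ x, 0 ≤ v x) :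
    1 / 4 * pairing 0 u v ≤ pairing 0 (face true u) (face true v) +
      300 * (∑ x, slice 0 (face false v) x * twoPointKL (face false u x) (face true u x) +
        ∑ x, face false u x *
          twoPointKL (slice 0 (face false v) x) (slice 0 (face true v) x)) := by
  rw [pairing_zero_succ, pairing_add_left]
  simp only [pairing_comm 0 (face _ u) (face _ v)]
  simp only [pairing, ← sum_add_distrib, mul_sum]
  refine sum_le_sum fun x _ => ?_
  have h := two_point_inequality (hu (Fin.cons false x)) (hu (Fin.cons true x))
    (slice_nonneg (j := 0) (u := face false v) (fun _ => hv _) x)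
    (slice_nonneg (j := 0) (u := face true v) (fun _ => hv _) x)
  simp only [face] at h ⊢
  linarith

theorem mul_pairing_zero_le {u v : Cube n → ℝ} (hu : ∀ x, 0 ≤ u x) (hv : ∀ x, 0 ≤ v x) :
    1 / 4 * (n * pairing 0 u v) ≤ pairing 1 u v + 300 * (condKL u v + condKL v u) := by
  induction n with
  | zero => simp [pairing, slice, condKL, interCard]
  | succ n ih =>
    have ih_false := ih (u := face false u + face true u) (v := face false v)
      (fun _ => add_nonneg (hu _) (hu _)) fun _ => hv _
    have ih_true := ih (u := face false u) (v := face true v) (fun _ => hu _) fun _ => hv _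
    have hfirst := pairing_zero_le_succ hu hv
    have hsplit := congrArg (fun t : ℝ => 1 / 4 * (n * t)) (pairing_zero_succ u v)
    rw [pairing_one_succ, condKL_succ_last u v, condKL_succ_first v u]
    push_cast
    linarith

theorem negMulLog_add_mul_log_le {s z : ℝ} (hs : 0 ≤ s) (hz : 0 < z) (a : ℝ) :
    negMulLog s + s * log z ≤ a * s + exp (-a) * z := by
  have h := sub_le_mul_log_sub_log hs (mul_pos (exp_pos (-a)) hz)
  rw [log_mul (exp_ne_zero _) hz.ne', log_exp] at h
  unfold negMulLog
  linarith

theorem condKL_indicator_le (A B : Set (Cube n)) (a : ℝ) :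
    condKL (A.indicator 1) (B.indicator 1) ≤
      a * pairing 0 (A.indicator 1) (B.indicator 1) + exp (-a) * 3 ^ n := by
  have hA : ∀ x, (0 : ℝ) ≤ A.indicator 1 x := Set.indicator_nonneg fun _ _ => zero_le_one
  have hentropy : negMulLog ∘ A.indicator (1 : Cube n → ℝ) = 0 := by
    funext x
    by_cases hx : x ∈ A <;> simp [hx]
  rw [← pairing_zero_one_one]
  simp only [condKL, pairing, mul_sum, ← sum_add_distrib, hentropy]
  refine sum_le_sum fun y _ => ?_
  have hy := negMulLog_add_mul_log_le (slice_nonneg (j := 0) hA y) (slice_zero_one_pos y) a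
  have hzero : slice 0 (0 : Cube n → ℝ) y = 0 := by simp [slice]
  have hpos := mul_pos (exp_pos (-a)) (slice_zero_one_pos y)
  by_cases hyB : y ∈ B <;> simp only [hyB, Set.indicator_of_mem, Set.indicator_of_notMem, hzero,
    not_false_eq_true, Pi.one_apply, one_mul, zero_mul, mul_zero, sub_zero] <;> linarith

open Classical in
theorem rectangle_bound (A B : Set (Cube n)) :
    5 / 24 * (n * #{p ∈ pairs n 0 | p.1 ∈ A ∧ p.2 ∈ B}) ≤
      #{p ∈ pairs n 1 | p.1 ∈ A ∧ p.2 ∈ B} +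
        600 * (exp (-(n / 14400)) * 3 ^ n) := by
  have h := mul_pairing_zero_le (u := A.indicator 1) (v := B.indicator 1)
    (Set.indicator_nonneg fun _ _ => zero_le_one) (Set.indicator_nonneg fun _ _ => zero_le_one)
  -- With this parameter the two entropies consume only `2 * 300 / 14400 = 1 / 24` of the `1 / 4`.
  have hAB := condKL_indicator_le A B (n / 14400)
  have hBA := condKL_indicator_le B A (n / 14400)
  rw [pairing_comm 0 (B.indicator 1)] at hBA
  rw [← pairing_indicator, ← pairing_indicator]
  linarith

/-- The pairs satisfying `P` on which `τ` takes a given value form a combinatorial rectangle: this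
is what one knows of the inputs rejected by a two-party protocol with transcript `τ`. -/
def IsRectangular {α β κ : Type*} (P : α → β → Prop) (τ : α → β → κ) : Prop :=
  ∀ ⦃x y x' y'⦄, P x y → P x' y' → τ x y = τ x' y' → P x y' ∧ τ x y' = τ x y

theorem IsRectangular.exists_rectangles {α β κ : Type*} {P : α → β → Prop} {τ : α → β → κ}
    (h : IsRectangular P τ) : ∃ (A : κ → Set α) (B : κ → Set β), ∀ t x y,
      P x y ∧ τ x y = t ↔ x ∈ A t ∧ y ∈ B t := by
  refine ⟨fun t => {x | ∃ y, P x y ∧ τ x y = t}, fun t => {y | ∃ x, P x y ∧ τ x y = t},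
    fun t x y => ⟨fun hxy => ⟨⟨y, hxy⟩, x, hxy⟩, ?_⟩⟩
  rintro ⟨⟨y', hP, hτ⟩, x', hP', hτ'⟩
  obtain ⟨hP'', hτ''⟩ := h hP hP' (hτ.trans hτ'.symm)
  exact ⟨hP'', hτ''.trans hτ⟩

open Classical in
theorem IsRectangular.mul_card_disjoint_le {κ : Type*} [Fintype κ] {P : Cube n → Cube n → Prop}
    {τ : Cube n → Cube n → κ} (h : IsRectangular P τ) :
    5 / 24 * (n * #{p ∈ pairs n 0 | P p.1 p.2}) ≤
      #{p ∈ pairs n 1 | P p.1 p.2} +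
        Fintype.card κ * (600 * (exp (-(n / 14400)) * 3 ^ n)) := by
  obtain ⟨A, B, hAB⟩ := h.exists_rectangles
  have hcard (j : ℕ) : #{p ∈ pairs n j | P p.1 p.2} =
      ∑ t, #{p ∈ pairs n j | p.1 ∈ A t ∧ p.2 ∈ B t} := by
    rw [card_eq_sum_card_fiberwise (f := fun p => τ p.1 p.2) (t := univ) (by simp)]
    simp only [filter_filter, hAB]
  rw [hcard, hcard, ← nsmul_eq_mul (Fintype.card κ), ← card_univ, ← sum_const]
  push_cast
  rw [mul_sum, mul_sum, ← sum_add_distrib]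
  exact sum_le_sum fun t _ => rectangle_bound (A t) (B t)

section Counting

open MeasureTheory

variable {Ω ι : Type*} [MeasurableSpace Ω] {μ : Measure Ω} {s : Finset ι} {E : ι → Set Ω}

open Classical in
theorem integrable_card_filter_mem [IsFiniteMeasure μ] (hE : ∀ i ∈ s, MeasurableSet (E i)) :
    Integrable (fun ω => (#{i ∈ s | ω ∈ E i} : ℝ)) μ := by
  simp only [natCast_card_filter]
  exact integrable_finsetSum _ fun i hi =>
    ((integrable_const (1 : ℝ)).indicator (hE i hi)).congr (.of_forall fun ω => by
      simp [Set.indicator_apply])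

open Classical in
theorem integral_card_filter_mem [IsFiniteMeasure μ] (hE : ∀ i ∈ s, MeasurableSet (E i)) :
    ∫ ω, (#{i ∈ s | ω ∈ E i} : ℝ) ∂μ = ∑ i ∈ s, μ.real (E i) := by
  have hind (i : ι) : (fun ω => if ω ∈ E i then (1 : ℝ) else 0) = (E i).indicator 1 := by
    ext ω
    simp [Set.indicator_apply]
  simp only [natCast_card_filter]
  rw [integral_finsetSum]
  · refine sum_congr rfl fun i hi => ?_
    rw [hind, integral_indicator_one (hE i hi)]
  · intro i hi
    rw [hind]
    exact (integrable_const (1 : ℝ)).indicator (hE i hi)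

open Classical in
theorem mul_card_le_integral_card_filter_mem [IsFiniteMeasure μ]
    (hE : ∀ i ∈ s, MeasurableSet (E i)) {p : ℝ} (hp : ∀ i ∈ s, p ≤ μ.real (E i)) :
    p * #s ≤ ∫ ω, (#{i ∈ s | ω ∈ E i} : ℝ) ∂μ := by
  rw [integral_card_filter_mem hE, mul_comm, ← nsmul_eq_mul]
  exact card_nsmul_le_sum s _ p hp

end Counting

open Classical in
theorem IsRectangular.card_correct_le {κ : Type*} [Fintype κ] {reject : Cube n → Cube n → Prop}
    {τ : Cube n → Cube n → κ} (h : IsRectangular reject τ) {C : Cube n → Cube n → Prop}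
    (hC : ∀ x y, C x y → (reject x y ↔ interCard x y = 0)) :
    5 / 24 * (n * #{p ∈ pairs n 0 | C p.1 p.2}) + #{p ∈ pairs n 1 | C p.1 p.2} ≤
      #(pairs n 1) + Fintype.card κ * (600 * (exp (-(n / 14400)) * 3 ^ n)) := by
  have hdisjoint : (#{p ∈ pairs n 0 | C p.1 p.2} : ℝ) ≤ #{p ∈ pairs n 0 | reject p.1 p.2} := by
    refine mod_cast card_le_card fun p hp => ?_
    rw [mem_filter] at hp ⊢
    exact ⟨hp.1, (hC _ _ hp.2).2 (mem_pairs.1 hp.1)⟩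
  have hunique : (#{p ∈ pairs n 1 | C p.1 p.2} : ℝ) ≤ #{p ∈ pairs n 1 | ¬ reject p.1 p.2} := by
    refine mod_cast card_le_card fun p hp => ?_
    rw [mem_filter] at hp ⊢
    exact ⟨hp.1, fun hr => one_ne_zero ((mem_pairs.1 hp.1).symm.trans ((hC _ _ hp.2).1 hr))⟩
  have hsum : (#{p ∈ pairs n 1 | reject p.1 p.2} + #{p ∈ pairs n 1 | ¬ reject p.1 p.2} : ℝ) =
      #(pairs n 1) := by
    exact_mod_cast card_filter_add_card_filter_not (s := pairs n 1) fun p => reject p.1 p.2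
  linarith [h.mul_card_disjoint_le, mul_le_mul_of_nonneg_left hdisjoint n.cast_nonneg]

section Randomized

open MeasureTheory

variable {Ω κ : Type*} [MeasurableSpace Ω] {μ : Measure Ω} [IsProbabilityMeasure μ] [Fintype κ]
  {reject : Ω → Cube n → Cube n → Prop} {τ : Ω → Cube n → Cube n → κ}
  {E : Cube n → Cube n → Set Ω}

theorem div_le_card_mul_of_randomized (hrect : ∀ ω, IsRectangular (reject ω) (τ ω))
    (hcorrect : ∀ x y, ∀ ω ∈ E x y, reject ω x y ↔ interCard x y = 0)
    (hmeas : ∀ x y, MeasurableSet (E x y)) (hprob : ∀ x y, (2 / 3 : ℝ) ≤ μ.real (E x y)) :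
    (n : ℝ) / 36 ≤ Fintype.card κ * (600 * exp (-(n / 14400))) := by
  classical
  have hlower (j : ℕ) :
      2 / 3 * #(pairs n j) ≤ ∫ ω, (#{p ∈ pairs n j | ω ∈ E p.1 p.2} : ℝ) ∂μ :=
    mul_card_le_integral_card_filter_mem (fun p _ => hmeas p.1 p.2) fun p _ => hprob p.1 p.2
  have hintegrable (j : ℕ) : Integrable (fun ω => (#{p ∈ pairs n j | ω ∈ E p.1 p.2} : ℝ)) μ :=
    integrable_card_filter_mem fun p _ => hmeas p.1 p.2
  have hintegrable_zero := ((hintegrable 0).const_mul (n : ℝ)).const_mul (5 / 24)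
  have hpoint (ω : Ω) := (hrect ω).card_correct_le (C := fun x y => ω ∈ E x y) fun x y =>
    hcorrect x y ω
  have hupper := integral_mono (hintegrable_zero.add (hintegrable 1)) (integrable_const _) hpoint
  rw [integral_add' hintegrable_zero (hintegrable 1), integral_const_mul, integral_const_mul,
    integral_const, probReal_univ, one_smul] at hupper
  have hzero := mul_le_mul_of_nonneg_left (hlower 0) n.cast_nonneg
  have hone := hlower 1
  rw [card_pairs, pairing_zero_one_one] at hzero
  rw [card_pairs, pairing_one_one_one] at hone hupper
  refine le_of_mul_le_mul_right ?_ (by positivity : (0 : ℝ) < 3 ^ n)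
  linarith

/-- The randomized two-party communication complexity of disjointness is linear in `n`: the
logarithm of the number of transcripts bounds the number of exchanged bits from below. -/
theorem le_log_card_of_randomized (hrect : ∀ ω, IsRectangular (reject ω) (τ ω))
    (hcorrect : ∀ x y, ∀ ω ∈ E x y, reject ω x y ↔ interCard x y = 0)
    (hmeas : ∀ x y, MeasurableSet (E x y)) (hprob : ∀ x y, (2 / 3 : ℝ) ≤ μ.real (E x y)) :
    n ≤ 14400 * (10 + log (Fintype.card κ)) := by
  rcases n.eq_zero_or_pos with rfl | hn
  · have := log_natCast_nonneg (Fintype.card κ)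
    norm_num
    linarith
  have hn' : (1 : ℝ) ≤ n := by exact_mod_cast hn
  have h := div_le_card_mul_of_randomized hrect hcorrect hmeas hprob
  have hcard : (0 : ℝ) < Fintype.card κ := by
    refine pos_of_mul_pos_left (lt_of_lt_of_le ?_ h) (by positivity)
    positivity
  have hexp : exp (n / 14400) ≤ 21600 * Fintype.card κ := by
    have h' := mul_le_mul_of_nonneg_right h (exp_pos (n / 14400)).le
    rw [exp_neg, mul_assoc, mul_assoc, inv_mul_cancel₀ (exp_ne_zero _)] at h'
    linarith [mul_le_mul_of_nonneg_right hn' (exp_pos (n / 14400 : ℝ)).le]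
  have hlog : log 21600 ≤ 10 := by
    rw [log_le_iff_le_exp (by norm_num)]
    calc (21600 : ℝ) ≤ 2.7182818283 ^ 10 := by norm_num
      _ ≤ exp 1 ^ 10 := by gcongr; exact exp_one_gt_d9.le
      _ = exp 10 := by rw [← exp_nat_mul]; norm_num
  have := (le_log_iff_exp_le (by positivity)).2 hexp
  rw [log_mul (by norm_num) hcard.ne'] at this
  linarith

end Randomized

end UniqueDisjointness

namespace Congest

open UniqueDisjointness

theorem message_injective (b : ℕ) : Function.Injective
    (fun m : Message b => (⟨⟨m.1.length, Nat.lt_succ_of_le m.2⟩, ⟨m.1, rfl⟩⟩ :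
      Σ i : Fin (b + 1), List.Vector Bool i)) := by
  intro m m' h
  exact Subtype.ext (congrArg (fun s : Σ i : Fin (b + 1), List.Vector Bool i => s.2.1) h)

noncomputable instance (b : ℕ) : Fintype (Message b) :=
  Fintype.ofInjective _ (message_injective b)

theorem card_message_le (b : ℕ) : Fintype.card (Message b) ≤ 2 ^ (b + 1) := by
  refine (Fintype.card_le_of_injective _ (message_injective b)).trans ?_
  simp only [Fintype.card_sigma, card_vector, Fintype.card_bool]
  rw [Fin.sum_univ_eq_sum_range (fun i => 2 ^ i)]
  exact (Nat.geomSum_lt le_rfl (by simp)).le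

variable {n b : ℕ}

theorem Algorithm.run_succ_congr (A : Algorithm n b) {G H : SimpleGraph (Fin n)} {t : ℕ} {v : Fin n}
    (hneighbors : G.neighborSet v = H.neighborSet v) (hstate : A.run G t v = A.run H t v)
    (hmessage : ∀ w ∈ H.neighborSet v, A.send (A.run G t w) v = A.send (A.run H t w) v) :
    A.run G (t + 1) v = A.run H (t + 1) v := by
  have hadj (w : Fin n) : G.Adj w v ↔ H.Adj w v := by
    rw [G.adj_comm, H.adj_comm]
    exact Set.ext_iff.1 hneighbors w
  simp only [Algorithm.run, hstate]
  congr 1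
  funext w
  by_cases hw : H.Adj w v
  · rw [if_pos hw, if_pos ((hadj w).2 hw), hmessage w hw.symm]
  · rw [if_neg hw, if_neg (mt (hadj w).1 hw)]

/-- The messages that `A` sends along the ordered pairs of vertices in `cut` during the first `T`
rounds on `G`. -/
noncomputable def transcript {C : Type*} (A : Algorithm n b) (cut : C → Fin n × Fin n) (T : ℕ)
    (G : SimpleGraph (Fin n)) : Fin T → C → Message b :=
  fun t c => A.send (A.run G t (cut c).1) (cut c).2

theorem log_card_transcript_le {C : Type*} [Fintype C] [DecidableEq C] {T : ℕ} :
    Real.log (Fintype.card (Fin T → C → Message b)) ≤ (b + 1) * Fintype.card C * T := by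
  have hmessage : Real.log (Fintype.card (Message b)) ≤ b + 1 := by
    have hpos : 0 < Fintype.card (Message b) := Fintype.card_pos_iff.2 ⟨Message.silent b⟩
    calc Real.log (Fintype.card (Message b)) ≤ Real.log ((2 : ℝ) ^ (b + 1)) :=
          Real.log_le_log (mod_cast hpos) (mod_cast card_message_le b)
      _ = (b + 1) * Real.log 2 := by rw [Real.log_pow, Nat.cast_add_one]
      _ ≤ b + 1 := mul_le_of_le_one_right (by positivity) (by linarith [Real.log_two_lt_d9])
  calc Real.log (Fintype.card (Fin T → C → Message b))
      = T * (Fintype.card C * Real.log (Fintype.card (Message b))) := by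
        rw [Fintype.card_fun, Fintype.card_fun, Fintype.card_fin, Nat.cast_pow, Nat.cast_pow,
          Real.log_pow, Real.log_pow]
    _ ≤ T * (Fintype.card C * (b + 1)) := by gcongr
    _ = (b + 1) * Fintype.card C * T := by ring

section Split

variable {V W α β α' β' C : Type*} {G : α → β → SimpleGraph V} {S : Set V} {cut : C → V × V}

/-- A family of graphs that two players can simulate together: the first player knows `x` and hence
the edges at the vertices in `S`, the second player knows `y` and hence the edges at the other
vertices, and all edges between `S` and its complement are, in both directions, among the ordered
pairs `cut`. -/
structure IsSplit (G : α → β → SimpleGraph V) (S : Set V) (cut : C → V × V) : Prop where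
  near : ∀ x y y', ∀ v ∈ S, (G x y).neighborSet v = (G x y').neighborSet v
  far : ∀ x x' y, ∀ v ∉ S, (G x y).neighborSet v = (G x' y).neighborSet v
  cut : ∀ x y, ∀ v ∈ S, ∀ w ∉ S, (G x y).Adj v w → (v, w) ∈ Set.range cut ∧ (w, v) ∈ Set.range cut

theorem IsSplit.swap (h : IsSplit G S cut) : IsSplit (fun y x => G x y) Sᶜ cut where
  near y x x' v hv := h.far x x' y v hv
  far y y' x v hv := h.near x y y' v (not_not.1 hv)
  cut y x v hv w hw hvw := (h.cut x y w (not_not.1 hw) v hv hvw.symm).symm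

theorem IsSplit.comap (h : IsSplit G S cut) (f : α' → α) (g : β' → β) (e : W ≃ V) :
    IsSplit (fun x y => (G (f x) (g y)).comap e) (e ⁻¹' S) (Prod.map e.symm e.symm ∘ cut) where
  near x y y' v hv := congrArg (e ⁻¹' ·) (h.near (f x) (g y) (g y') (e v) hv)
  far x x' y v hv := congrArg (e ⁻¹' ·) (h.far (f x) (f x') (g y) (e v) hv)
  cut x y v hv w hw hvw := by
    obtain ⟨⟨c, hc⟩, c', hc'⟩ := h.cut (f x) (g y) (e v) hv (e w) hw hvw
    exact ⟨⟨c, by simp [hc]⟩, c', by simp [hc']⟩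

end Split

section Simulation

variable {α β C : Type*} {G : α → β → SimpleGraph (Fin n)} {S : Set (Fin n)}
  {cut : C → Fin n × Fin n} {x x' : α} {y y' : β} {t T : ℕ}

theorem IsSplit.run_succ_eq (h : IsSplit G S cut) (A : Algorithm n b)
    (hcut : ∀ c, A.send (A.run (G x y) t (cut c).1) (cut c).2 =
      A.send (A.run (G x' y') t (cut c).1) (cut c).2)
    (hnear : ∀ v ∈ S, A.run (G x y') t v = A.run (G x y) t v)
    (hfar : ∀ v ∉ S, A.run (G x y') t v = A.run (G x' y') t v) {v : Fin n} (hv : v ∈ S) :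
    A.run (G x y') (t + 1) v = A.run (G x y) (t + 1) v := by
  refine A.run_succ_congr (h.near x y' y v hv) (hnear v hv) fun w hw => ?_
  by_cases hwS : w ∈ S
  · rw [hnear w hwS]
  · obtain ⟨c, hc⟩ := (h.cut x y v hv w hwS hw).2
    simpa only [hc, hfar w hwS] using (hcut c).symm

theorem IsSplit.run_eq (h : IsSplit G S cut) (A : Algorithm n b)
    (hτ : transcript A cut T (G x y) = transcript A cut T (G x' y')) (ht : t ≤ T) :
    (∀ v ∈ S, A.run (G x y') t v = A.run (G x y) t v) ∧
      ∀ v ∉ S, A.run (G x y') t v = A.run (G x' y') t v := by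
  induction t with
  | zero =>
    exact ⟨fun v hv => congrArg (A.init v) (h.near x y' y v hv),
      fun v hv => congrArg (A.init v) (h.far x x' y' v hv)⟩
  | succ t ih =>
    obtain ⟨hnear, hfar⟩ := ih (Nat.le_of_succ_le ht)
    have hcut (c : C) := congrFun (congrFun hτ ⟨t, ht⟩) c
    exact ⟨fun v hv => h.run_succ_eq A hcut hnear hfar hv,
      fun v hv => h.swap.run_succ_eq A (fun c => (hcut c).symm) hfar
        (fun w hw => hnear w (not_not.1 hw)) hv⟩

theorem IsSplit.isRectangular (h : IsSplit G S cut) (A : Algorithm n b) (T : ℕ) :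
    IsRectangular (fun x y => ¬ A.Accepts T (G x y)) fun x y => transcript A cut T (G x y) := by
  intro x y x' y' hxy hxy' hτ
  obtain ⟨hnear, hfar⟩ := h.run_eq A hτ le_rfl
  constructor
  · rintro ⟨v, hv⟩
    by_cases hvS : v ∈ S
    · exact hxy ⟨v, by rwa [← hnear v hvS]⟩
    · exact hxy' ⟨v, by rwa [← hfar v hvS]⟩
  · funext t c
    obtain ⟨hnear, hfar⟩ := h.run_eq A hτ t.2.le
    by_cases hc : (cut c).1 ∈ S
    · simp only [transcript, hnear _ hc]
    · rw [hτ]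
      simp only [transcript, hfar _ hc]

theorem card_le_of_randomizedSolves {N m : ℕ} [Fintype C]
    {G : Cube N → Cube N → SimpleGraph (Fin n)} (hsplit : IsSplit G S cut)
    (hconn : ∀ x y, (G x y).Connected)
    (hcycle : ∀ x y, (SimpleGraph.cycleGraph m).IsIndContained (G x y) ↔ interCard x y ≠ 0)
    {Ω : Type*} [MeasurableSpace Ω] {μ : MeasureTheory.Measure Ω}
    [MeasureTheory.IsProbabilityMeasure μ] {A : Ω → Algorithm n b}
    (hA : RandomizedSolvesInducedCycle μ A m T) :
    N ≤ 14400 * (10 + (b + 1) * Fintype.card C * T : ℝ) := by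
  classical
  have h := le_log_card_of_randomized (μ := μ) (fun ω => hsplit.isRectangular (A ω) T)
    (E := fun x y => {ω | (A ω).CorrectOn m T (G x y)})
    (fun x y ω hω => not_iff_comm.1 ((hω.trans (hcycle x y)).symm.trans (by simp)))
    (fun x y => (hA _ (hconn x y)).1) fun x y => (hA _ (hconn x y)).2
  linarith [log_card_transcript_le (b := b) (C := C) (T := T)]

end Simulation

end Congest

namespace LayeredGraph

section CyclicWalk

variable {L : ℕ}

theorem natCast_ne_zero {c : ℕ} (hc : 0 < c) (hcL : c < L) : (c : ZMod L) ≠ 0 :=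
  mt (ZMod.natCast_eq_zero_iff c L).1 (Nat.not_dvd_of_pos_of_lt hc hcL)

theorem val_add_one_of_ne_zero [NeZero L] {w : ZMod L} (h : w + 1 ≠ 0) :
    (w + 1).val = w.val + 1 := by
  have hlt : w.val + 1 < L := lt_of_le_of_ne (ZMod.val_lt w) fun e => h <| by
    rw [← ZMod.natCast_zmod_val w, ← Nat.cast_add_one, e, ZMod.natCast_self]
  have : Fact (1 < L) := ⟨by omega⟩
  rw [ZMod.val_add_of_lt, ZMod.val_one]
  rwa [ZMod.val_one]

theorem exists_cycleGraph_equiv_zmod (hL : 2 ≤ L) : ∃ e : Fin L ≃ ZMod L, ∀ s t,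
    (SimpleGraph.cycleGraph L).Adj s t ↔ e s - e t = 1 ∨ e t - e s = 1 := by
  obtain ⟨N, rfl⟩ := Nat.exists_eq_add_of_le' hL
  exact ⟨Equiv.refl _, fun _ _ => SimpleGraph.cycleGraph_adj⟩

-- Around a maximum, the sequence would have to rise, stay constant for one step, and fall.
theorem exists_eq_add_two_or_add_three [NeZero L] {f : ZMod L → ℕ}
    (hstep : ∀ t, f t = f (t + 1) ∨ f (t + 1) = f t + 1 ∨ f t = f (t + 1) + 1) :
    ∃ t, f t = f (t + 2) ∨ f t = f (t + 3) := by
  by_contra! hne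
  obtain ⟨t, ht⟩ := Finite.exists_max f
  have no_plateau (s) (hs : f (s + 1) = f t) (hs' : f (s + 2) = f t) : False := by
    have hbefore := hstep s
    have hafter := hstep (s + 2)
    have htwo := (hne (s + 1)).1
    rw [show s + 2 + 1 = s + 3 by ring] at hafter
    rw [show s + 1 + 2 = s + 3 by ring] at htwo
    have := ht s
    have := ht (s + 3)
    have := hne s
    omega
  have hbefore := hstep (t - 1)
  have hafter := hstep t
  have htwo := (hne (t - 1)).1
  rw [show t - 1 + 2 = t + 1 by ring] at htwo
  rw [sub_add_cancel] at hbefore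
  have hbefore_ne : f (t - 1) ≠ f t := fun e =>
    no_plateau (t - 2) (by rwa [show t - 2 + 1 = t - 1 by ring]) (by rw [sub_add_cancel])
  have hafter_ne : f (t + 1) ≠ f t := fun e =>
    no_plateau (t - 1) (by rw [sub_add_cancel]) (by rwa [show t - 1 + 2 = t + 1 by ring])
  have := ht (t - 1)
  have := ht (t + 1)
  omega

variable {h : ZMod L → ZMod L}

theorem surjective_of_step [NeZero L] (hL : 5 ≤ L)
    (hstep : ∀ t, h t = h (t + 1) ∨ h (t + 1) = h t + 1 ∨ h t = h (t + 1) + 1)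
    (hfib : ∀ s t, h s = h t → s = t ∨ s - t = 1 ∨ t - s = 1) : Function.Surjective h := by
  by_contra hns
  obtain ⟨z, hz⟩ := not_forall.1 hns
  have hup {s t} (hst : h t = h s + 1) : (h t - z).val = (h s - z).val + 1 := by
    rw [hst, add_sub_right_comm, val_add_one_of_ne_zero]
    rw [← add_sub_right_comm, ← hst]
    exact sub_ne_zero.2 fun e => hz ⟨t, e⟩
  obtain ⟨t, ht⟩ := exists_eq_add_two_or_add_three (f := fun t => (h t - z).val) fun t =>
    (hstep t).imp (congrArg fun l => (l - z).val) (Or.imp hup hup)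
  have hdist {c : ℕ} (hc : c = 2 ∨ c = 3) (e : h t = h (t + c)) : False := by
    have h1 : ((c - 1 : ℕ) : ZMod L) ≠ 0 := natCast_ne_zero (by omega) (by omega)
    have h2 : (c : ZMod L) ≠ 0 := natCast_ne_zero (by omega) (by omega)
    have h3 : ((c + 1 : ℕ) : ZMod L) ≠ 0 := natCast_ne_zero (by omega) (by omega)
    rw [Nat.cast_sub (by omega), Nat.cast_one] at h1
    rw [Nat.cast_add, Nat.cast_one] at h3
    rcases hfib _ _ e with e | e | e
    · exact h2 (by linear_combination -e)
    · exact h3 (by linear_combination -e)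
    · exact h1 (by linear_combination e)
  have hlevel {s t} (e : (h s - z).val = (h t - z).val) : h s = h t :=
    sub_left_injective (ZMod.val_injective _ e)
  exact ht.elim (fun e => hdist (.inl rfl) (hlevel e)) fun e => hdist (.inr rfl) (hlevel e)

theorem exists_section [NeZero L] (hL : 5 ≤ L)
    (hstep : ∀ t, h t = h (t + 1) ∨ h (t + 1) = h t + 1 ∨ h t = h (t + 1) + 1)
    (hfib : ∀ s t, h s = h t → s = t ∨ s - t = 1 ∨ t - s = 1) :
    ∃ σ : ZMod L → ZMod L, (∀ l, h (σ l) = l) ∧ ∀ l, σ (l + 1) - σ l = 1 ∨ σ l - σ (l + 1) = 1 := by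
  have hsurj := surjective_of_step hL hstep hfib
  have hinj : Function.Injective h := Finite.injective_iff_surjective.2 hsurj
  have h1 : ((1 : ℕ) : ZMod L) ≠ 0 := natCast_ne_zero (by omega) (by omega)
  have h2 : ((2 : ℕ) : ZMod L) ≠ 0 := natCast_ne_zero (by omega) (by omega)
  push_cast at h1 h2
  choose σ hσ using hsurj
  refine ⟨σ, hσ, fun l => ?_⟩
  have eq_of_level {s} (hs : h s = l + 1) : σ (l + 1) = s := hinj ((hσ _).trans hs.symm)
  have hnext := hstep (σ l)
  have hprev := hstep (σ l - 1)
  rw [sub_add_cancel] at hprev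
  rw [hσ] at hnext hprev
  rcases hnext with e | e | e
  · exact absurd (hinj ((hσ l).trans e)) (by simpa using h1)
  · rw [eq_of_level e]
    simp
  · rcases hprev with e' | e' | e'
    · exact absurd (hinj (e'.trans (hσ l).symm)) (by simpa using h1)
    · exact absurd (hinj (add_right_cancel (e'.symm.trans e))) fun e =>
        h2 (by linear_combination -e)
    · rw [eq_of_level e']
      simp

end CyclicWalk

variable {L : ℕ} {ι ρ : Type*}

/-- The vertices of the layered graphs: one vertex for each element of `ι` on each of `L` cyclically
ordered levels, and further padding vertices `ρ`, which adjust the number of vertices. -/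
abbrev Vertex (L : ℕ) (ι ρ : Type*) : Type _ := (ZMod L × ι) ⊕ ρ

/-- The level of a vertex. The padding vertices are put on level `2`. -/
def level : Vertex L ι ρ → ZMod L
  | .inl p => p.1
  | .inr _ => 2

/-- The relation joining each level to the next one, where `R l` prescribes which vertices of levels
`l` and `l + 1` are joined. -/
def Up (R : ZMod L → ι → ι → Prop) : Vertex L ι ρ → Vertex L ι ρ → Prop
  | .inl (l, i), .inl (l', j) => l' = l + 1 ∧ R l i j
  | _, _ => False

/-- The graph whose levels are cliques and whose consecutive levels `l` and `l + 1` are joined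
according to `R l`. -/
def layered (ρ : Type*) (R : ZMod L → ι → ι → Prop) : SimpleGraph (Vertex L ι ρ) where
  Adj a b := a ≠ b ∧ (level a = level b ∨ Up R a b ∨ Up R b a)
  symm := ⟨fun _ _ h => ⟨h.1.symm, h.2.imp Eq.symm Or.symm⟩⟩
  loopless := ⟨fun _ h => h.1 rfl⟩

variable {R R' : ZMod L → ι → ι → Prop} {a b : Vertex L ι ρ}

theorem level_eq_or_of_adj (h : (layered ρ R).Adj a b) :
    level a = level b ∨ level b = level a + 1 ∨ level a = level b + 1 := by
  rcases a with ⟨l, i⟩ | a <;> rcases b with ⟨l', j⟩ | b <;>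
    simp only [layered, Up, level] at h ⊢ <;> tauto

theorem exists_of_adj_succ (hL : 3 ≤ L) (h : (layered ρ R).Adj a b)
    (hlevel : level b = level a + 1) :
    ∃ i j, a = .inl (level a, i) ∧ b = .inl (level a + 1, j) ∧ R (level a) i j := by
  have h1 : ((1 : ℕ) : ZMod L) ≠ 0 := natCast_ne_zero (by omega) (by omega)
  have h2 : ((2 : ℕ) : ZMod L) ≠ 0 := natCast_ne_zero (by omega) (by omega)
  push_cast at h1 h2
  obtain ⟨-, h | h | h⟩ := h
  · exact absurd (h.trans hlevel) (by simpa using h1)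
  · rcases a with ⟨l, i⟩ | a <;> rcases b with ⟨l', j⟩ | b <;> simp only [Up] at h
    obtain ⟨rfl, h⟩ := h
    exact ⟨i, j, rfl, rfl, h⟩
  · rcases a with ⟨l, i⟩ | a <;> rcases b with ⟨l', j⟩ | b <;> simp only [Up, level] at h hlevel
    exact absurd (by linear_combination -h.1 - hlevel) h2

theorem exists_cycle_of_isIndContained (hL : 5 ≤ L)
    (h : (SimpleGraph.cycleGraph L).IsIndContained (layered ρ R)) :
    ∃ c : ZMod L → ι, ∀ l, R l (c l) (c (l + 1)) := by
  obtain ⟨f⟩ := h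
  have : NeZero L := ⟨by omega⟩
  obtain ⟨e, he⟩ := exists_cycleGraph_equiv_zmod (L := L) (by omega)
  let g (t : ZMod L) : Vertex L ι ρ := f (e.symm t)
  have hadj (s t : ZMod L) : (layered ρ R).Adj (g s) (g t) ↔ s - t = 1 ∨ t - s = 1 :=
    f.map_adj_iff.trans ((he _ _).trans (by simp only [Equiv.apply_symm_apply]))
  obtain ⟨σ, hσ, hstep⟩ := exists_section (h := level ∘ g) hL
    (fun t => level_eq_or_of_adj ((hadj _ _).2 (.inr (by ring))))
    fun s t hst => or_iff_not_imp_left.2 fun hne =>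
      (hadj s t).1 ⟨(f.injective.comp e.symm.injective).ne hne, .inl hst⟩
  simp only [Function.comp_apply] at hσ
  have hpair (l : ZMod L) := exists_of_adj_succ (by omega) ((hadj _ _).2 (hstep l).symm)
    (by rw [hσ, hσ])
  simp only [hσ] at hpair
  choose c d hc hd hR using hpair
  refine ⟨c, fun l => ?_⟩
  obtain rfl : d = fun l => c (l + 1) := funext fun l => by simpa using (hd l).symm.trans (hc _)
  exact hR l

theorem isIndContained_of_cycle (hL : 2 ≤ L) {c : ZMod L → ι} (hc : ∀ l, R l (c l) (c (l + 1))) :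
    (SimpleGraph.cycleGraph L).IsIndContained (layered ρ R) := by
  obtain ⟨e, he⟩ := exists_cycleGraph_equiv_zmod hL
  have h1 : ((1 : ℕ) : ZMod L) ≠ 0 := natCast_ne_zero (by omega) (by omega)
  push_cast at h1
  have hadj (l : ZMod L) : (layered ρ R).Adj (.inl (l, c l)) (.inl (l + 1, c (l + 1))) :=
    ⟨fun e => h1 (by simpa [level] using congrArg level e), .inr (.inl ⟨rfl, hc l⟩)⟩
  refine ⟨⟨⟨fun s => .inl (e s, c (e s)), fun s t hst => e.injective ?_⟩, fun {s t} => ?_⟩⟩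
  · exact congrArg Prod.fst (Sum.inl_injective hst)
  · rw [he]
    change (layered ρ R).Adj (.inl (e s, c (e s))) (.inl (e t, c (e t))) ↔ _
    generalize e s = l, e t = l'
    rw [sub_eq_iff_eq_add', sub_eq_iff_eq_add']
    constructor
    · rintro ⟨hne, rfl | h | h⟩
      exacts [absurd rfl hne, .inr h.1, .inl h.1]
    · rintro (rfl | rfl)
      exacts [(hadj _).symm, hadj _]

theorem isIndContained_layered_iff (hL : 5 ≤ L) :
    (SimpleGraph.cycleGraph L).IsIndContained (layered ρ R) ↔
      ∃ c : ZMod L → ι, ∀ l, R l (c l) (c (l + 1)) :=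
  ⟨exists_cycle_of_isIndContained hL, fun ⟨_, hc⟩ => isIndContained_of_cycle (by omega) hc⟩

theorem reachable_of_level_eq (h : level a = level b) : (layered ρ R).Reachable a b := by
  rcases eq_or_ne a b with rfl | hne
  · rfl
  · exact SimpleGraph.Adj.reachable ⟨hne, .inl h⟩

theorem layered_connected (hL : 2 ≤ L) [Nonempty ι] (l₀ : ZMod L)
    (hR : ∀ l ≠ l₀, ∃ i j, R l i j) : (layered ρ R).Connected := by
  have : NeZero L := ⟨by omega⟩
  let root : Vertex L ι ρ := .inl (l₀ + 1, Classical.arbitrary ι)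
  have hroot (s : ℕ) (hs : s < L) (v : Vertex L ι ρ) (hv : level v = l₀ + 1 + s) :
      (layered ρ R).Reachable root v := by
    induction s generalizing v with
    | zero => exact reachable_of_level_eq (by rw [hv, Nat.cast_zero, add_zero]; rfl)
    | succ s ih =>
      obtain ⟨i, j, hij⟩ := hR (l₀ + 1 + s) fun e =>
        natCast_ne_zero s.succ_pos hs (by push_cast; linear_combination e)
      have h1 : ((1 : ℕ) : ZMod L) ≠ 0 := natCast_ne_zero (by omega) (by omega)
      have hadj : (layered ρ R).Adj (.inl (l₀ + 1 + s, i)) (.inl (l₀ + 1 + s + 1, j)) :=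
        ⟨fun e => h1 (by simpa [level] using congrArg level e), .inr (.inl ⟨rfl, hij⟩)⟩
      refine (ih (by omega) _ rfl).trans (hadj.reachable.trans (reachable_of_level_eq ?_))
      rw [hv, Nat.cast_succ, ← add_assoc]
      rfl
  refine (SimpleGraph.connected_iff_exists_forall_reachable _).2 ⟨root, fun v => ?_⟩
  refine hroot (level v - (l₀ + 1)).val (ZMod.val_lt _) v ?_
  rw [ZMod.natCast_zmod_val]
  ring

theorem neighborSet_layered_congr (hup : R (level a) = R' (level a))
    (hdown : R (level a - 1) = R' (level a - 1)) :
    (layered ρ R).neighborSet a = (layered ρ R').neighborSet a := by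
  have hUp : ∀ b : Vertex L ι ρ, Up R a b ↔ Up R' a b := by
    rcases a with ⟨l, i⟩ | a <;> rintro (⟨l', j⟩ | _) <;> simp_all [Up, level]
  have hDown : ∀ b : Vertex L ι ρ, Up R b a ↔ Up R' b a := by
    rcases a with ⟨l, i⟩ | a <;> rintro (⟨l', j⟩ | _) <;> simp only [Up]
    refine and_congr_right fun hl => ?_
    obtain rfl : l - 1 = l' := sub_eq_of_eq_add hl
    exact iff_of_eq (congrFun (congrFun hdown j) i)
  ext b
  simp only [SimpleGraph.mem_neighborSet, layered, hUp, hDown]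

/-- The joining relations of the hard instances: the first input `X` joins levels `0` and `1`, the
second input `Y`, transposed, joins levels `2` and `3`, and all other consecutive levels are joined
by a perfect matching. A closed walk through all levels then stays on `i` from level `3` to level
`0`, and on `j` from level `1` to level `2`, where `(i, j)` is a common element of `X` and `Y`. -/
def link (X Y : ι → ι → Prop) (l : ZMod L) (i j : ι) : Prop :=
  if l = 0 then X i j else if l = 2 then Y j i else i = j

theorem exists_cycle_link_iff (hL : 3 ≤ L) {X Y : ι → ι → Prop} :
    (∃ c : ZMod L → ι, ∀ l, link X Y l (c l) (c (l + 1))) ↔ ∃ i j, X i j ∧ Y i j := by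
  have h1 : ((1 : ℕ) : ZMod L) ≠ 0 := natCast_ne_zero (by omega) (by omega)
  have h2 : ((2 : ℕ) : ZMod L) ≠ 0 := natCast_ne_zero (by omega) (by omega)
  push_cast at h1 h2
  have h12 : (1 : ZMod L) ≠ 2 := fun e => h1 (by linear_combination -e)
  constructor
  · rintro ⟨c, hc⟩
    have hconst (t : ℕ) (ht : 3 ≤ t) (htL : t ≤ L) : c t = c 3 := by
      induction t, ht using Nat.le_induction with
      | base => rfl
      | succ t ht ih =>
        have ht0 := natCast_ne_zero (c := t) (L := L) (by omega) (by omega)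
        have ht2 := natCast_ne_zero (c := t - 2) (L := L) (by omega) (by omega)
        rw [Nat.cast_sub (by omega), sub_ne_zero, Nat.cast_two] at ht2
        have := hc t
        rw [link, if_neg ht0, if_neg ht2] at this
        rw [Nat.cast_succ, ← this, ih (by omega)]
    have hclose : c 0 = c 3 := by simpa using hconst L hL le_rfl
    have hX := hc 0
    have hmatch := hc 1
    have hY := hc 2
    rw [link, if_pos rfl, zero_add] at hX
    rw [link, if_neg h1, if_neg h12, one_add_one_eq_two] at hmatch
    rw [link, if_neg h2, if_pos rfl, two_add_one_eq_three, ← hclose, ← hmatch] at hY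
    exact ⟨_, _, hX, hY⟩
  · rintro ⟨i, j, hX, hY⟩
    refine ⟨fun l => if l = 1 ∨ l = 2 then j else i, fun l => ?_⟩
    rcases eq_or_ne l 0 with rfl | hl0
    · simpa [link, h1.symm, h2.symm] using hX
    rcases eq_or_ne l 2 with rfl | hl2
    · have h31 : (2 + 1 : ZMod L) ≠ 1 := by simpa using h2
      have h32 : (2 + 1 : ZMod L) ≠ 2 := by simpa using h1
      simpa only [link, if_neg h2, if_pos, h31, h32, or_self, or_true, if_false] using hY
    rcases eq_or_ne l 1 with rfl | hl1
    · simp [link, h1, h12, one_add_one_eq_two]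
    · have hl1' : l + 1 ≠ 2 := fun e => hl1 (by linear_combination e)
      simp [link, hl0, hl1, hl2, hl1']

open Congest UniqueDisjointness

/-- The ordered pairs of adjacent vertices of which exactly one is on level `0` or `1`, when these
two levels are matched with level `-1` and level `2`, respectively. -/
def cutPair : Bool × Bool × ι → Vertex L ι ρ × Vertex L ι ρ
  | (false, false, i) => (.inl (1, i), .inl (2, i))
  | (false, true, i) => (.inl (2, i), .inl (1, i))
  | (true, false, i) => (.inl (0, i), .inl (-1, i))
  | (true, true, i) => (.inl (-1, i), .inl (0, i))

theorem mem_range_cutPair (hL : 4 ≤ L) {X Y : ι → ι → Prop} (ha : level a = 0 ∨ level a = 1)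
    (hb : ¬ (level b = 0 ∨ level b = 1)) (hab : (layered ρ (link X Y)).Adj a b) :
    (a, b) ∈ Set.range cutPair ∧ (b, a) ∈ Set.range cutPair := by
  have h1 : ((1 : ℕ) : ZMod L) ≠ 0 := natCast_ne_zero (by omega) (by omega)
  have h3 : ((3 : ℕ) : ZMod L) ≠ 0 := natCast_ne_zero (by omega) (by omega)
  push_cast at h1 h3
  have h12 : (1 : ZMod L) ≠ 2 := fun e => h1 (by linear_combination -e)
  rcases level_eq_or_of_adj hab with e | e | e
  · exact absurd (e ▸ ha) hb
  · obtain ⟨i, j, hi, hj, hij⟩ := exists_of_adj_succ (by omega) hab e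
    rcases ha with ha | ha <;> rw [ha] at e hi hj hij
    · exact absurd (.inr (by rw [e, zero_add])) hb
    · obtain rfl : i = j := by simpa only [link, if_neg h1, if_neg h12] using hij
      rw [one_add_one_eq_two] at hj
      rw [hi, hj]
      exact ⟨⟨(false, false, i), rfl⟩, (false, true, i), rfl⟩
  · obtain ⟨i, j, hi, hj, hij⟩ := exists_of_adj_succ (by omega) hab.symm e
    rcases ha with ha | ha <;> rw [ha] at e
    · have hlevel : level b = -1 := eq_neg_of_add_eq_zero_left e.symm
      have h02 : (-1 : ZMod L) ≠ 2 := fun e => h3 (by linear_combination -e)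
      rw [hlevel] at hi hj hij
      obtain rfl : i = j := by simpa only [link, if_neg (neg_ne_zero.2 h1), if_neg h02] using hij
      rw [neg_add_cancel] at hj
      rw [hi, hj]
      exact ⟨⟨(true, false, i), rfl⟩, (true, true, i), rfl⟩
    · exact absurd (.inl (by linear_combination -e)) hb

theorem isSplit_layered (hL : 4 ≤ L) :
    IsSplit (fun X Y => layered ρ (link X Y)) {v : Vertex L ι ρ | level v = 0 ∨ level v = 1}
      cutPair where
  near X Y Y' v hv := by
    have h1 : ((1 : ℕ) : ZMod L) ≠ 0 := natCast_ne_zero (by omega) (by omega)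
    have h2 : ((2 : ℕ) : ZMod L) ≠ 0 := natCast_ne_zero (by omega) (by omega)
    have h3 : ((3 : ℕ) : ZMod L) ≠ 0 := natCast_ne_zero (by omega) (by omega)
    push_cast at h1 h2 h3
    have link_congr {l : ZMod L} (hl : l ≠ 2) : link X Y l = link X Y' l := by
      funext i j
      simp only [link, if_neg hl]
    rcases hv with hv | hv <;> refine neighborSet_layered_congr ?_ ?_ <;> rw [hv] <;>
      refine link_congr fun e => ?_
    · exact h2 e.symm
    · exact h3 (by linear_combination -e)
    · exact h1 (by linear_combination -e)
    · exact h2 (by linear_combination -e)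
  far X X' Y v hv := by
    have link_congr {l : ZMod L} (hl : l ≠ 0) : link X Y l = link X' Y l := by
      funext i j
      simp only [link, if_neg hl]
    obtain ⟨h0, h1⟩ := not_or.1 hv
    exact neighborSet_layered_congr (link_congr h0) (link_congr (sub_ne_zero.2 h1))
  cut _ _ _ hv _ hw hvw := mem_range_cutPair hL hv hw hvw

variable {p : ℕ} {x y : Cube (p * p)}

/-- The relation on `p + 1` elements encoded by `p * p` bits. The additional element `none` is
related to itself if `b` holds, and to nothing else. -/
def entry (b : Prop) (x : Cube (p * p)) : Option (Fin p) → Option (Fin p) → Prop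
  | some i, some j => x (finProdFinEquiv (i, j)) = true
  | none, none => b
  | _, _ => False

theorem exists_entry_iff :
    (∃ i j, entry True x i j ∧ entry False y i j) ↔ interCard x y ≠ 0 := by
  rw [interCard_ne_zero]
  constructor
  · rintro ⟨_ | i, _ | j, hx, hy⟩
    all_goals simp only [entry] at hx hy
    exact ⟨_, hx, hy⟩
  · rintro ⟨s, hs⟩
    obtain ⟨⟨i, j⟩, rfl⟩ := finProdFinEquiv.surjective s
    exact ⟨some i, some j, hs⟩

theorem layered_link_connected (hL : 3 ≤ L) :
    (layered ρ (link (L := L) (entry True x) (entry False y))).Connected := by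
  refine layered_connected (by omega) 2 fun l hl => ⟨none, none, ?_⟩
  simp [link, hl, entry]

theorem exists_hard_instances {m n p : ℕ} (hm : 5 ≤ m) (hn : m * (p + 1) ≤ n) :
    ∃ (G : Cube (p * p) → Cube (p * p) → SimpleGraph (Fin n)) (S : Set (Fin n))
      (cut : Bool × Bool × Option (Fin p) → Fin n × Fin n), IsSplit G S cut ∧
        (∀ x y, (G x y).Connected) ∧
        ∀ x y, (SimpleGraph.cycleGraph m).IsIndContained (G x y) ↔ interCard x y ≠ 0 := by
  have : NeZero m := ⟨by omega⟩
  have hcard : Fintype.card (Vertex m (Option (Fin p)) (Fin (n - m * (p + 1)))) = n := by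
    simp only [Fintype.card_sum, Fintype.card_prod, ZMod.card, Fintype.card_option,
      Fintype.card_fin]
    omega
  let e := (Fintype.equivFinOfCardEq hcard).symm
  let Γ (x y : Cube (p * p)) := layered (Fin (n - m * (p + 1)))
    (link (L := m) (entry True x) (entry False y))
  have iso (x y) : (Γ x y).comap e ≃g Γ x y := SimpleGraph.Iso.comap e (Γ x y)
  refine ⟨_, _, _, (isSplit_layered (by omega)).comap (entry True) (entry False) e,
    fun x y => (iso x y).connected_iff.2 (layered_link_connected (by omega)), fun x y => ?_⟩
  calc (SimpleGraph.cycleGraph m).IsIndContained ((Γ x y).comap e)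
      ↔ (SimpleGraph.cycleGraph m).IsIndContained (Γ x y) :=
        ⟨fun ⟨f⟩ => ⟨(iso x y).toEmbedding.comp f⟩, fun ⟨f⟩ => ⟨(iso x y).symm.toEmbedding.comp f⟩⟩
    _ ↔ ∃ c : ZMod m → _, ∀ l, link (entry True x) (entry False y) l (c l) (c (l + 1)) :=
        isIndContained_layered_iff hm
    _ ↔ ∃ i j, entry True x i j ∧ entry False y i j := exists_cycle_link_iff (by omega)
    _ ↔ interCard x y ≠ 0 := exists_entry_iff

end LayeredGraph

namespace Congest

open MeasureTheory

variable {n b m T : ℕ}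

theorem Algorithm.SolvesInducedCycle.randomized {A : Algorithm n b}
    (hA : A.SolvesInducedCycle m T) {Ω : Type*} [MeasurableSpace Ω] (μ : Measure Ω)
    [IsProbabilityMeasure μ] : RandomizedSolvesInducedCycle μ (fun _ => A) m T := by
  intro G hG
  simp only [hA G hG, Set.ofPred_true]
  exact ⟨MeasurableSet.univ, by norm_num⟩

variable {Ω : Type*} [MeasurableSpace Ω] {μ : Measure Ω} [IsProbabilityMeasure μ]
  {A : Ω → Algorithm n b}

theorem le_mul_rounds {p : ℕ} (hm : 5 ≤ m) (hp : 1000 ≤ p) (hn : m * (p + 1) ≤ n)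
    (hA : RandomizedSolvesInducedCycle μ A m T) : (p : ℝ) ≤ 70000 * ((b + 1) * T) := by
  obtain ⟨G, S, cut, hsplit, hconn, hcycle⟩ := LayeredGraph.exists_hard_instances hm hn
  have h := card_le_of_randomizedSolves hsplit hconn hcycle hA
  simp only [Fintype.card_prod, Fintype.card_bool, Fintype.card_option, Fintype.card_fin] at h
  push_cast at h
  have hp' : (1000 : ℝ) ≤ p := mod_cast hp
  have hmul := mul_le_mul_of_nonneg_right hp' (by positivity : (0 : ℝ) ≤ (b + 1) * T)
  refine le_of_mul_le_mul_right ?_ (by linarith : (0 : ℝ) < p)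
  nlinarith

theorem div_le_rounds (hm : 5 ≤ m) (hn : 1002 * m ≤ n)
    (hA : RandomizedSolvesInducedCycle μ A m T) : n / (140000 * m * (b + 1)) ≤ (T : ℝ) := by
  obtain ⟨p, hp⟩ : ∃ p, n / m = p + 1 := Nat.exists_eq_add_one.2 (Nat.div_pos (by omega) (by omega))
  have hp_large : 1002 ≤ p + 1 := hp ▸ (Nat.le_div_iff_mul_le (by omega)).2 hn
  have hp_le : m * (p + 1) ≤ n := hp ▸ Nat.mul_div_le n m
  have hp_lt : n < m * (p + 1 + 1) := hp ▸ Nat.lt_mul_div_succ n (by omega)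
  have h2p : n ≤ 2 * (p * m) := by nlinarith
  rw [div_le_iff₀ (by positivity)]
  calc (n : ℝ) ≤ 2 * (p * m) := mod_cast h2p
    _ ≤ 2 * (70000 * ((b + 1) * T) * m) := by
      gcongr
      exact le_mul_rounds hm (by omega) hp_le hA
    _ = T * (140000 * m * (b + 1)) := by ring

theorem add_one_le_mul_log {β : ℝ} (hn : 3 ≤ n) (hb : b ≤ β * Real.log n) :
    (b + 1 : ℝ) ≤ (|β| + 1) * Real.log n := by
  have hexp : Real.exp 1 ≤ n := Real.exp_one_lt_d9.le.trans (by
    have : (3 : ℝ) ≤ n := mod_cast hn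
    linarith)
  have hlog : 1 ≤ Real.log n := (Real.le_log_iff_exp_le ((Real.exp_pos 1).trans_le hexp)).2 hexp
  have := mul_le_mul_of_nonneg_right (le_abs_self β) (zero_le_one.trans hlog)
  linarith

theorem mul_div_log_le_rounds {β : ℝ} (hm : 5 ≤ m) (hn : 1002 * m ≤ n) (hb : b ≤ β * Real.log n)
    (hA : RandomizedSolvesInducedCycle μ A m T) :
    1 / (140000 * m * (|β| + 1)) * (n / Real.log n) ≤ T := by
  have hb' := add_one_le_mul_log (by omega) hb
  calc 1 / (140000 * m * (|β| + 1)) * (n / Real.log n)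
      = n / (140000 * m * ((|β| + 1) * Real.log n)) := by
        rw [div_mul_div_comm, one_mul, mul_assoc (140000 * (m : ℝ))]
    _ ≤ n / (140000 * m * (b + 1)) := by gcongr
    _ ≤ T := div_le_rounds hm hn hA

end Congest

theorem mainTheorem1_general (m : ℕ) (hm : 5 ≤ m) (β : ℝ) :
    ∃ c : ℝ, 0 < c ∧ ∃ n₀ : ℕ, ∀ n : ℕ, n₀ ≤ n → ∀ b : ℕ, (b : ℝ) ≤ β * Real.log n → ∀ T : ℕ,
      (∀ A : Congest.Algorithm n b, A.SolvesInducedCycle m T → c * (n / Real.log n) ≤ T) ∧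
      (∀ (Ω : Type*) [MeasurableSpace Ω] (μ : MeasureTheory.Measure Ω)
        [MeasureTheory.IsProbabilityMeasure μ] (A : Ω → Congest.Algorithm n b),
        Congest.RandomizedSolvesInducedCycle μ A m T → c * (n / Real.log n) ≤ T) := by
  refine ⟨1 / (140000 * m * (|β| + 1)), by positivity, 1002 * m, fun n hn b hb T =>
    ⟨fun A hA => ?_, fun Ω _ μ _ A hA => Congest.mul_div_log_le_rounds hm hn hb hA⟩⟩
  exact Congest.mul_div_log_le_rounds hm hn hb (hA.randomized (MeasureTheory.Measure.dirac ()))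

theorem mainTheorem1 (k : ℕ) (hk : 3 ≤ k) (β : ℝ) :
    ∃ c : ℝ, 0 < c ∧ ∃ n₀ : ℕ, ∀ n : ℕ, n₀ ≤ n → ∀ b : ℕ, (b : ℝ) ≤ β * Real.log n → ∀ T : ℕ,
      (∀ A : Congest.Algorithm n b, A.SolvesInducedCycle (2 * k) T →
        c * (n / Real.log n) ≤ T) ∧
      (∀ (Ω : Type*) [MeasurableSpace Ω] (μ : MeasureTheory.Measure Ω)
        [MeasureTheory.IsProbabilityMeasure μ] (A : Ω → Congest.Algorithm n b),
        Congest.RandomizedSolvesInducedCycle μ A (2 * k) T →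
          c * (n / Real.log n) ≤ T) :=
  mainTheorem1_general (2 * k) (by omega) β
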